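/- For real $a,b>0$ let $\Phi_{a,b}(z)={}_1F_1(a;a+b;z)=\sum_{k\ge 0}\frac{(a)_k}{(a+b)_k}\frac{z^k}{k!}$, where $(x)_k=x(x+1)\cdots(x+k-1)$, and define the hypergeometric zeta function by $\zeta^H_{a,b}(s)=\sum_{k}z_k^{-s}$ for $\operatorname{Re}s>1$, where $z_k$ runs over the complex zeros of $\Phi_{a,b}$, counted with multiplicity. For $b>0$ let the hypergeometric Bernoulli numbers $B_n^{(b)}$ be defined by the Taylor expansion $$\frac{1}{\Phi_{1,b}(z)}=\sum_{n=0}^{\infty}B_n^{(b)}\frac{z^n}{n!}$$ at $z=0$. **Theorem.** Let $b\ge 1$ be an integer. Then $B_0^{(b)}=1$ and $B_1^{(b)}=-\frac{1}{1+b}$, and for every integer $n\ge 2$ the series defining $\zeta^H_{1,b}(n)$ converges absolutely and $$B_n^{(b)}=-\frac{n!\,\zeta^H_{1,b}(n)}{b}.$$ -/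

import Mathlib

open scoped Nat

noncomputable section

/-- The Kummer function `M(a, c; z) = ₁F₁(a; c; z) = ∑ (a)_k / (c)_k * z^k / k!`. -/
def kummerM (a c z : ℂ) : ℂ :=
  ∑' k : ℕ, (ascPochhammer ℂ k).eval a / (ascPochhammer ℂ k).eval c * z ^ k / (k ! : ℂ)

/-- The function `Φ_{a,b}(z) = M(a, a + b; z)`. -/
def kummerPhi (a b : ℝ) (z : ℂ) : ℂ :=
  kummerM (a : ℂ) ((a : ℂ) + (b : ℂ)) z

/-- The set of complex zeros of `Φ_{a,b}`. -/
def kummerZeros (a b : ℝ) : Set ℂ :=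
  {w : ℂ | kummerPhi a b w = 0}

/-- The contribution `1 / w ^ s` of a zero `w` of `Φ_{a,b}`, taken with the multiplicity of `w`
(for non-integral `s` the power is the principal one). -/
def hypergeometricZetaTerm (a b : ℝ) (s : ℂ) (w : kummerZeros a b) : ℂ :=
  (analyticOrderNatAt (kummerPhi a b) (w : ℂ) : ℂ) * (1 / (w : ℂ) ^ s)

/-- The hypergeometric zeta function `ζ^H_{a,b}(s) = ∑ 1 / z_k ^ s`, the sum being over all
complex zeros `z_k` of `Φ_{a,b}`, counted with multiplicity. -/
def hypergeometricZeta (a b : ℝ) (s : ℂ) : ℂ :=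
  ∑' w : kummerZeros a b, hypergeometricZetaTerm a b s w

/-- The hypergeometric Bernoulli numbers `B_n^{(b)}`, defined by the Taylor expansion
`1 / Φ_{1,b}(z) = ∑ B_n^{(b)} * z^n / n!` at `0`; that is, `B_n^{(b)}` is the `n`-th derivative
of `1 / Φ_{1,b}` at `0`. -/
def hypergeometricBernoulli (b : ℝ) (n : ℕ) : ℂ :=
  iteratedDeriv n (fun z : ℂ => 1 / kummerPhi 1 b z) 0

end

open Metric Filter Topology ComplexConjugate

/-! Write `f` for `Φ_{1,b}`. Kummer's equation degenerates at `a = 1` to `z f' = (z - b) f + b`. At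
a zero `w` this reads `w f'(w) = b ≠ 0`, so all zeros are simple; dividing by `b f` gives `1/f = 1 -
z/b + (z/b) f'/f`. Hence the Bernoulli numbers are, up to explicit factors, Taylor coefficients of
`f'/f`.

It remains to identify the coefficients of index `m ≥ 1` with power sums of reciprocal zeros
(`hasSum_inv_pow_zeros`). Since `|f(z)| ≤ exp |z|`, this needs no Hadamard product: on `|z| < R`
remove the zeros by Blaschke factors. The zero-free quotient has a logarithm with real part `O(R)`,
so by Borel–Carathéodory and Cauchy its contribution is `O(R ^ (-m))`. The reflected zeros
contribute the same order by Jensen's count, and `R → ∞` finishes. -/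

/-- An entire function vanishing simply on a finite set is the product of the linear factors with
an entire function not vanishing on the set. -/
lemma exists_eq_prod_sub_mul {f : ℂ → ℂ} (hf : Differentiable ℂ f) (S : Finset ℂ)
    (hS : ∀ w ∈ S, f w = 0) :
    ∃ h : ℂ → ℂ, Differentiable ℂ h ∧ ∀ z, f z = (∏ w ∈ S, (z - w)) * h z := by
  classical
  induction S using Finset.induction_on with
  | empty => exact ⟨f, hf, by simp⟩
  | insert a S ha ih =>
    obtain ⟨h, hh, hfh⟩ := ih fun w hw => hS w (Finset.mem_insert_of_mem hw)
    have hha : h a = 0 := by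
      have h1 := hS a (Finset.mem_insert_self a S)
      rw [hfh, mul_eq_zero, Finset.prod_eq_zero_iff] at h1
      rcases h1 with ⟨w, hw, hw'⟩ | h1
      · exact absurd ((sub_eq_zero.mp hw') ▸ hw) ha
      · exact h1
    refine ⟨dslope h a, ?_, fun z => ?_⟩
    · rw [← differentiableOn_univ, Complex.differentiableOn_dslope univ_mem]
      exact hh.differentiableOn
    · have h2 := sub_smul_dslope h a z
      rw [hha, sub_zero, smul_eq_mul] at h2
      rw [Finset.prod_insert ha, hfh, ← h2]
      ring

lemma ne_zero_of_eq_prod_sub_mul {f h : ℂ → ℂ} (hh : Differentiable ℂ h) {S : Finset ℂ}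
    (hfh : ∀ z, f z = (∏ w ∈ S, (z - w)) * h z) {w : ℂ} (hw : w ∈ S) (hd : deriv f w ≠ 0) :
    h w ≠ 0 := by
  classical
  intro h0
  apply hd
  have hP : DifferentiableAt ℂ (fun z : ℂ => ∏ w ∈ S, (z - w)) w := by fun_prop
  rw [funext hfh, deriv_fun_mul hP (hh w), h0, Finset.prod_eq_zero hw (sub_self w)]
  simp

/-! ### Logarithms of zero-free functions on a disc -/

/-- A holomorphic nonvanishing function on a disc has a holomorphic logarithm. -/
lemma exists_exp_eq_of_ball {g : ℂ → ℂ} {R : ℝ} (hR : 0 < R) (hg : DifferentiableOn ℂ g (ball 0 R))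
    (h0 : ∀ z ∈ ball (0 : ℂ) R, g z ≠ 0) :
    ∃ G : ℂ → ℂ, (∀ z ∈ ball (0 : ℂ) R, HasDerivAt G (logDeriv g z) z) ∧
      ∀ z ∈ ball (0 : ℂ) R, Complex.exp (G z) = g z := by
  have hq : DifferentiableOn ℂ (logDeriv g) (ball 0 R) := (hg.deriv isOpen_ball).div hg h0
  obtain ⟨G, hG0, hG⟩ := hq.isExactOn_ball.with_val_at 0 (Complex.log (g 0))
  have hmem : (0 : ℂ) ∈ ball (0 : ℂ) R := mem_ball_self hR
  refine ⟨G, hG, fun z hz => ?_⟩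
  have hd : ∀ z ∈ ball (0 : ℂ) R, HasDerivAt (fun z => Complex.exp (-G z) * g z) 0 z := by
    intro z hz
    have h1 := ((hG z hz).neg.cexp).mul
      ((hg.differentiableAt (isOpen_ball.mem_nhds hz)).hasDerivAt)
    convert! h1 using 1
    have := h0 z hz
    rw [logDeriv_apply]
    field_simp
    simp
  have hc := (convex_ball (0 : ℂ) R).is_const_of_fderivWithin_eq_zero (𝕜 := ℂ)
    (f := fun z => Complex.exp (-G z) * g z)
    (fun z hz => (hd z hz).differentiableAt.differentiableWithinAt)
    (fun z hz => by
      rw [fderivWithin_of_isOpen isOpen_ball hz, (hd z hz).hasFDerivAt.fderiv]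
      ext; simp) hz hmem
  have hc' : Complex.exp (-G z) * g z = 1 := by
    refine hc.trans ?_
    rw [hG0, Complex.exp_neg, Complex.exp_log (h0 0 hmem), inv_mul_cancel₀ (h0 0 hmem)]
  rw [Complex.exp_neg] at hc'
  have := Complex.exp_ne_zero (G z)
  field_simp at hc'
  exact hc'.symm

/-- Taylor coefficients of the logarithmic derivative of a nonvanishing function bounded by
`exp A` on a disc, and of modulus at least one at the centre. -/
lemma norm_iteratedDeriv_logDeriv_le {g : ℂ → ℂ} {R A : ℝ} (hR : 0 < R) (hA : 0 < A)
    (hg : DifferentiableOn ℂ g (ball 0 R)) (h0 : ∀ z ∈ ball (0 : ℂ) R, g z ≠ 0)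
    (hb : ∀ z ∈ ball (0 : ℂ) R, ‖g z‖ ≤ Real.exp A) (h1 : 1 ≤ ‖g 0‖) (m : ℕ) :
    ‖iteratedDeriv m (logDeriv g) 0‖ ≤ (m + 1)! * (2 * A) / (R / 2) ^ (m + 1) := by
  obtain ⟨G, hG, hexp⟩ := exists_exp_eq_of_ball hR hg h0
  have hmem : (0 : ℂ) ∈ ball (0 : ℂ) R := mem_ball_self hR
  have hre : ∀ z ∈ ball (0 : ℂ) R, Real.exp (G z).re = ‖g z‖ := fun z hz => by
    rw [← hexp z hz, Complex.norm_exp]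
  have hre0 : 0 ≤ (G 0).re := by
    rw [← Real.one_le_exp_iff, hre 0 hmem]; exact h1
  have hGd : DifferentiableOn ℂ (fun z => G z - G 0) (ball 0 R) := fun z hz =>
    ((hG z hz).differentiableAt.sub_const _).differentiableWithinAt
  have hhalf : closedBall (0 : ℂ) (R / 2) ⊆ ball 0 R := closedBall_subset_ball (by linarith)
  have hbound : ∀ z ∈ sphere (0 : ℂ) (R / 2), ‖G z - G 0‖ ≤ 2 * A := by
    intro z hz
    have hzn : ‖z‖ = R / 2 := by simpa using hz
    have hzR : z ∈ ball (0 : ℂ) R := by rw [mem_ball_zero_iff, hzn]; linarith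
    -- At `|z| = R/2` the Borel–Carathéodory factor `2|z|/(R - |z|)` equals 2. The real part of `G -
    -- G 0` is at most `A` because `1 ≤ ‖g 0‖` makes `Re (G 0)` nonnegative.
    have := Complex.borelCaratheodory_zero (f := fun z => G z - G 0) hA hGd
      (fun x hx => ?_) hR hzR (by simp)
    · refine this.trans_eq ?_
      rw [hzn]; field_simp; ring
    · have h2 : (G x).re ≤ A := by
        rw [← Real.exp_le_exp, hre x hx]; exact hb x hx
      simp only [Set.mem_ofPred_eq, Complex.sub_re]
      linarith
  have hcauchy := Complex.norm_iteratedDeriv_le_of_forall_mem_sphere_norm_le (m + 1)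
    (half_pos hR) (f := fun z => G z - G 0) (c := 0)
    ((hGd.mono hhalf).diffContOnCl_ball subset_rfl) hbound
  rw [iteratedDeriv_succ'] at hcauchy
  have hev : deriv (fun z => G z - G 0) =ᶠ[𝓝 0] logDeriv g := by
    filter_upwards [isOpen_ball.mem_nhds hmem] with z hz
    exact ((hG z hz).sub_const _).deriv
  rwa [hev.iteratedDeriv_eq] at hcauchy

lemma iteratedDeriv_inv_sub_zero (m : ℕ) (w : ℂ) :
    iteratedDeriv m (fun z : ℂ => (z - w)⁻¹) 0 = -(m ! * w⁻¹ ^ (m + 1)) := by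
  have h := congrFun (iter_deriv_inv_linear_sub m (1 : ℂ) w) 0
  simp only [one_mul, one_pow, mul_one] at h
  rw [iteratedDeriv_eq_iterate, h]
  simp only [zero_sub]
  have h3 : (-1 - (m : ℤ)) = -((m + 1 : ℕ) : ℤ) := by push_cast; ring
  rw [h3, zpow_neg, zpow_natCast, ← inv_pow, inv_neg, neg_pow w⁻¹, neg_pow (1 : ℂ), pow_succ (-1 : ℂ)]
  have h4 : ((-1 : ℂ) ^ m) * (-1) ^ m = 1 := by rw [← mul_pow]; simp
  linear_combination (-(m ! : ℂ) * w⁻¹ ^ (m + 1)) * h4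

/-! ### Blaschke factors -/

/-- On the circle `z * conj z = R ^ 2`, so the two expressions differ by `z / R` and a conjugation.
Thus replacing factors `z - w` by reflected ones preserves boundary moduli. -/
lemma norm_sub_conj_mul_div {R : ℝ} (hR : 0 < R) {z : ℂ} (hz : ‖z‖ = R) (w : ℂ) :
    ‖(R : ℂ) - conj w / R * z‖ = ‖z - w‖ := by
  have hR' : (R : ℂ) ≠ 0 := by exact_mod_cast hR.ne'
  have h1 : (R : ℂ) - conj w / R * z = z / R * conj (z - w) := by
    have : z * conj z = (R : ℂ) ^ 2 := by
      rw [Complex.mul_conj, Complex.normSq_eq_norm_sq, hz]; push_cast; ring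
    rw [map_sub]
    field_simp
    linear_combination -this
  rw [h1, norm_mul, RCLike.norm_conj, norm_div, Complex.norm_real, hz, Real.norm_of_nonneg hR.le,
    div_self hR.ne', one_mul]

lemma sub_conj_mul_ne_zero {R : ℝ} (hR : 0 < R) {w z : ℂ} (hw : ‖w‖ < R) (hz : ‖z‖ < R) :
    (R : ℂ) - conj w / R * z ≠ 0 := by
  intro h
  have h1 : ‖(R : ℂ)‖ = ‖conj w / R * z‖ := congrArg norm (sub_eq_zero.mp h)
  rw [norm_mul, norm_div, RCLike.norm_conj, Complex.norm_real, Real.norm_of_nonneg hR.le] at h1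
  have h2 : ‖w‖ / R < 1 := (div_lt_one hR).mpr hw
  nlinarith [norm_nonneg z, div_nonneg (norm_nonneg w) hR.le]

/-- Removing the zeros of an entire function in a disc by Blaschke factors. -/
lemma exists_zero_free {f : ℂ → ℂ} (hf : Differentiable ℂ f) (hf0 : f 0 = 1)
    {R A : ℝ} (hR : 0 < R) (hb : ∀ z ∈ sphere (0 : ℂ) R, ‖f z‖ ≤ Real.exp A)
    (hs : ∀ w, f w = 0 → deriv f w ≠ 0)
    {S : Finset ℂ} (hS : ∀ w, w ∈ S ↔ f w = 0 ∧ ‖w‖ < R) :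
    ∃ g : ℂ → ℂ, Differentiable ℂ g ∧ (∀ z ∈ ball (0 : ℂ) R, g z ≠ 0) ∧
      (∀ z ∈ ball (0 : ℂ) R, ‖g z‖ ≤ Real.exp A) ∧ ‖g 0‖ = ∏ w ∈ S, R / ‖w‖ ∧
      ∀ᶠ z in 𝓝 (0 : ℂ), logDeriv g z =
        logDeriv f z - ∑ w ∈ S, ((z - w)⁻¹ - (z - R ^ 2 / conj w)⁻¹) := by
  obtain ⟨h, hh, hfh⟩ := exists_eq_prod_sub_mul hf S fun w hw => ((hS w).mp hw).1
  have hR' : (R : ℂ) ≠ 0 := by exact_mod_cast hR.ne'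
  have hSne : ∀ w ∈ S, w ≠ 0 := by
    rintro w hw rfl
    have := ((hS 0).mp hw).1
    simp [hf0] at this
  have hhne : ∀ z ∈ ball (0 : ℂ) R, h z ≠ 0 := by
    intro z hz h0
    have hz' : z ∈ S := (hS z).mpr ⟨by rw [hfh, h0, mul_zero], mem_ball_zero_iff.mp hz⟩
    exact ne_zero_of_eq_prod_sub_mul hh hfh hz' (hs z ((hS z).mp hz').1) h0
  have hQne : ∀ z ∈ ball (0 : ℂ) R, ∀ w ∈ S, (R : ℂ) - conj w / R * z ≠ 0 := fun z hz w hw =>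
    sub_conj_mul_ne_zero hR ((hS w).mp hw).2 (mem_ball_zero_iff.mp hz)
  have hgd : Differentiable ℂ (fun z => (∏ w ∈ S, ((R : ℂ) - conj w / R * z)) * h z) := by fun_prop
  refine ⟨fun z => (∏ w ∈ S, ((R : ℂ) - conj w / R * z)) * h z, hgd, fun z hz =>
    mul_ne_zero (Finset.prod_ne_zero_iff.mpr (hQne z hz)) (hhne z hz), fun z hz => ?_, ?_, ?_⟩
  -- Maximum modulus: on the boundary circle `g` and `f` have equal modulus.
  · refine Complex.norm_le_of_forall_mem_frontier_norm_le isBounded_ball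
      (hgd.diffContOnCl) (fun z hz => ?_) (subset_closure hz)
    rw [frontier_ball _ hR.ne'] at hz
    have hzn : ‖z‖ = R := by simpa using hz
    refine le_trans (le_of_eq ?_) (hb z hz)
    rw [hfh, norm_mul, norm_mul, norm_prod, norm_prod]
    congr 1
    exact Finset.prod_congr rfl fun w _ => norm_sub_conj_mul_div hR hzn w
  · have h1 := hfh 0
    rw [hf0] at h1
    have h2 := congrArg norm h1
    simp only [norm_one, zero_sub, norm_mul, norm_prod, norm_neg] at h2
    simp only [mul_zero, sub_zero, norm_mul, norm_prod, Complex.norm_real,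
      Real.norm_of_nonneg hR.le, Finset.prod_div_distrib]
    have h3 : ∏ w ∈ S, ‖w‖ ≠ 0 := Finset.prod_ne_zero_iff.mpr fun w hw => norm_ne_zero_iff.mpr
      (hSne w hw)
    rw [eq_div_iff h3]
    linear_combination -(∏ _w ∈ S, R) * h2
  · have hfne : ∀ᶠ z in 𝓝 (0 : ℂ), f z ≠ 0 :=
      hf.continuous.continuousAt.eventually_ne (by simp [hf0])
    filter_upwards [hfne, isOpen_ball.mem_nhds (mem_ball_self hR)] with z hfz hz
    have hPne : ∀ w ∈ S, z - w ≠ 0 := by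
      intro w hw h0
      rw [sub_eq_zero.mp h0] at hfz
      exact hfz ((hS w).mp hw).1
    have hhz := hhne z hz
    have hQz := hQne z hz
    rw [logDeriv_mul z (Finset.prod_ne_zero_iff.mpr hQz) hhz (by fun_prop) (hh z),
      logDeriv_prod hQz (fun _ _ => by fun_prop), funext hfh,
      logDeriv_mul z (Finset.prod_ne_zero_iff.mpr hPne) hhz (by fun_prop) (hh z),
      logDeriv_prod hPne (fun _ _ => by fun_prop), Finset.sum_sub_distrib]
    have e1 : ∀ w ∈ S, logDeriv (fun z : ℂ => z - w) z = (z - w)⁻¹ := fun w _ => by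
      simp [logDeriv_apply]
    have e2 : ∀ w ∈ S, logDeriv (fun z : ℂ => (R : ℂ) - conj w / R * z) z =
        (z - R ^ 2 / conj w)⁻¹ := fun w hw => by
      have hd : HasDerivAt (fun z : ℂ => (R : ℂ) - conj w / R * z) (-(conj w / R)) z := by
        simpa using ((hasDerivAt_id z).const_mul (conj w / R)).const_sub (R : ℂ)
      have hcw : conj w ≠ 0 := (map_ne_zero _).mpr (hSne w hw)
      have hq := hQz w hw
      rw [logDeriv_apply, hd.deriv, div_eq_iff hq, ← div_eq_inv_mul, eq_comm, div_eq_iff]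
      · field_simp
        ring
      · intro h0
        apply hq
        have : z = R ^ 2 / conj w := sub_eq_zero.mp h0
        rw [this]; field_simp; ring
    rw [Finset.sum_congr rfl e1, Finset.sum_congr rfl e2]
    ring

/-- Jensen's bound for the zeros of an entire function in a disc. -/
lemma prod_div_norm_le {f : ℂ → ℂ} (hf : Differentiable ℂ f) (hf0 : f 0 = 1)
    {R A : ℝ} (hR : 0 < R) (hb : ∀ z ∈ sphere (0 : ℂ) R, ‖f z‖ ≤ Real.exp A)
    (hs : ∀ w, f w = 0 → deriv f w ≠ 0)
    {S : Finset ℂ} (hS : ∀ w, w ∈ S ↔ f w = 0 ∧ ‖w‖ < R) :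
    ∏ w ∈ S, R / ‖w‖ ≤ Real.exp A := by
  obtain ⟨g, -, -, hgb, hg0, -⟩ := exists_zero_free hf hf0 hR hb hs hS
  exact hg0 ▸ hgb 0 (mem_ball_self hR)

/-- The Taylor coefficients of the logarithmic derivative of an entire function compared with the
power sums of the reciprocals of its zeros in a disc. -/
lemma norm_iteratedDeriv_logDeriv_add_sum_le {f : ℂ → ℂ} (hf : Differentiable ℂ f) (hf0 : f 0 = 1)
    {R A : ℝ} (hR : 0 < R) (hA : 0 < A) (hb : ∀ z ∈ sphere (0 : ℂ) R, ‖f z‖ ≤ Real.exp A)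
    (hs : ∀ w, f w = 0 → deriv f w ≠ 0)
    {S : Finset ℂ} (hS : ∀ w, w ∈ S ↔ f w = 0 ∧ ‖w‖ < R) (m : ℕ) :
    ‖iteratedDeriv m (logDeriv f) 0 + m ! * ∑ w ∈ S, w⁻¹ ^ (m + 1)‖ ≤
      (m + 1)! * (2 * A) / (R / 2) ^ (m + 1) + m ! * (S.card * (1 / R) ^ (m + 1)) := by
  obtain ⟨g, hg, hgne, hgb, hg0, hlog⟩ := exists_zero_free hf hf0 hR hb hs hS
  have hSne : ∀ w ∈ S, w ≠ 0 := by
    rintro w hw rfl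
    have := ((hS 0).mp hw).1
    simp [hf0] at this
  have h1 : 1 ≤ ‖g 0‖ := by
    rw [hg0]
    refine Finset.prod_induction _ (1 ≤ ·) (fun _ _ => one_le_mul_of_one_le_of_one_le) le_rfl
      fun w hw => ?_
    rw [one_le_div (norm_pos_iff.mpr (hSne w hw))]
    exact ((hS w).mp hw).2.le
  have hest := norm_iteratedDeriv_logDeriv_le hR hA hg.differentiableOn hgne hgb h1 m
  have hR' : (R : ℂ) ≠ 0 := by exact_mod_cast hR.ne'
  have hfc : ContDiffAt ℂ m (logDeriv f) 0 := by
    have ha : AnalyticAt ℂ f 0 := hf.analyticAt 0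
    exact (ha.deriv.div ha (by simp [hf0])).contDiffAt
  have hic : ∀ a : ℂ, a ≠ 0 → ContDiffAt ℂ m (fun z : ℂ => (z - a)⁻¹) 0 := fun a ha =>
    (contDiffAt_id.sub contDiffAt_const).inv (by simpa using ha)
  have hne2 : ∀ w ∈ S, (R : ℂ) ^ 2 / conj w ≠ 0 := fun w hw =>
    div_ne_zero (pow_ne_zero _ hR') ((map_ne_zero _).mpr (hSne w hw))
  have key : iteratedDeriv m (logDeriv g) 0 = iteratedDeriv m (logDeriv f) 0 -
      ∑ w ∈ S, (-(m ! * w⁻¹ ^ (m + 1)) - -(m ! * ((R : ℂ) ^ 2 / conj w)⁻¹ ^ (m + 1))) := by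
    rw [EventuallyEq.iteratedDeriv_eq m hlog, iteratedDeriv_fun_sub hfc
      (ContDiffAt.sum fun w hw => (hic w (hSne w hw)).sub (hic _ (hne2 w hw))),
      iteratedDeriv_fun_sum fun w hw => (hic w (hSne w hw)).sub (hic _ (hne2 w hw))]
    congr 1
    refine Finset.sum_congr rfl fun w hw => ?_
    rw [iteratedDeriv_fun_sub (hic w (hSne w hw)) (hic _ (hne2 w hw)),
      iteratedDeriv_inv_sub_zero, iteratedDeriv_inv_sub_zero]
  have e : iteratedDeriv m (logDeriv f) 0 + m ! * ∑ w ∈ S, w⁻¹ ^ (m + 1) =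
      iteratedDeriv m (logDeriv g) 0 +
        m ! * ∑ w ∈ S, ((R : ℂ) ^ 2 / conj w)⁻¹ ^ (m + 1) := by
    rw [key, Finset.sum_sub_distrib, Finset.sum_neg_distrib, Finset.sum_neg_distrib,
      ← Finset.mul_sum, ← Finset.mul_sum]
    ring
  rw [e]
  refine (norm_add_le _ _).trans (add_le_add hest ?_)
  rw [norm_mul, Complex.norm_natCast]
  gcongr
  rw [← nsmul_eq_mul]
  refine (norm_sum_le _ _).trans (Finset.sum_le_card_nsmul _ _ _ fun w hw => ?_)
  rw [norm_pow, norm_inv, norm_div, norm_pow, RCLike.norm_conj, Complex.norm_real,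
    Real.norm_of_nonneg hR.le, inv_div]
  refine pow_le_pow_left₀ (by positivity) ?_ _
  rw [div_le_div_iff₀ (by positivity) hR]
  nlinarith [((hS w).mp hw).2]

/-! ### Counting zeros and convergence of the power sums -/

/-- The zeros of an entire function of exponential type in a disc, counted. -/
lemma card_zeros_le {f : ℂ → ℂ} (hf : Differentiable ℂ f) (hf0 : f 0 = 1)
    {R A : ℝ} (hR : 0 < R) (hb : ∀ z ∈ sphere (0 : ℂ) (2 * R), ‖f z‖ ≤ Real.exp A)
    (hs : ∀ w, f w = 0 → deriv f w ≠ 0)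
    {S T : Finset ℂ} (hS : ∀ w, w ∈ S ↔ f w = 0 ∧ ‖w‖ < R)
    (hT : ∀ w, w ∈ T ↔ f w = 0 ∧ ‖w‖ < 2 * R) :
    S.card * Real.log 2 ≤ A := by
  have hTne : ∀ w ∈ T, 0 < ‖w‖ := by
    rintro w hw
    rw [norm_pos_iff]
    rintro rfl
    have := ((hT 0).mp hw).1
    simp [hf0] at this
  have hsub : S ⊆ T := fun w hw =>
    (hT w).mpr ⟨((hS w).mp hw).1, ((hS w).mp hw).2.trans (by linarith)⟩
  have h1 := prod_div_norm_le hf hf0 (by linarith) hb hs hT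
  -- In Jensen's product for radius `2 * R`, the factors outside `S` are at least 1 and those in `S`
  -- at least 2.
  have h2 : ∏ w ∈ S, 2 * R / ‖w‖ ≤ ∏ w ∈ T, 2 * R / ‖w‖ := by
    rw [← Finset.prod_sdiff hsub]
    refine le_mul_of_one_le_left (Finset.prod_nonneg fun w _ => by positivity) ?_
    refine Finset.prod_induction _ (1 ≤ ·) (fun _ _ => one_le_mul_of_one_le_of_one_le) le_rfl
      fun w hw => ?_
    rw [one_le_div (hTne w (Finset.mem_sdiff.mp hw).1)]
    exact ((hT w).mp (Finset.mem_sdiff.mp hw).1).2.le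
  have h3 : (2 : ℝ) ^ S.card ≤ ∏ w ∈ S, 2 * R / ‖w‖ := by
    rw [← Finset.prod_const]
    refine Finset.prod_le_prod (fun _ _ => by norm_num) fun w hw => ?_
    rw [le_div_iff₀ (hTne w (hsub hw))]
    linarith [((hS w).mp hw).2]
  have h4 := Real.log_le_log (by positivity) (h3.trans (h2.trans h1))
  rwa [Real.log_pow, Real.log_exp] at h4

lemma finite_zeros_ball {f : ℂ → ℂ} (hf : Differentiable ℂ f) (hf0 : f 0 ≠ 0) (R : ℝ) :
    {w : ℂ | f w = 0 ∧ ‖w‖ < R}.Finite := by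
  have ha : AnalyticOnNhd ℂ f Set.univ := fun z _ => hf.analyticAt z
  have hc : (f ⁻¹' {0})ᶜ ∈ codiscreteWithin (Set.univ : Set ℂ) :=
    ha.preimage_zero_mem_codiscreteWithin (x := 0) hf0 (Set.mem_univ _) isConnected_univ
  have hfin := (isCompact_closedBall (0 : ℂ) R).finite_sdiff_of_mem_codiscreteWithin
    (Filter.codiscreteWithin_mono (Set.subset_univ _) hc)
  refine hfin.subset fun w hw => ⟨?_, ?_⟩
  · simpa using hw.2.le
  · simpa using hw.1

/-- A set whose counting function grows at most linearly has summable inverse squares. -/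
lemma sum_inv_sq_le {Z : Set ℂ} {r C : ℝ} (hr : 0 < r) (hC : 0 ≤ C) (hZr : ∀ w ∈ Z, r ≤ ‖w‖)
    (hcard : ∀ R : ℝ, 0 < R → ∀ S : Finset ℂ, (∀ w ∈ S, w ∈ Z ∧ ‖w‖ < R) → S.card ≤ C * R)
    (u : Finset ℂ) (hu : ∀ w ∈ u, w ∈ Z) :
    ∑ w ∈ u, (‖w‖ ^ 2)⁻¹ ≤ 8 * C / r := by
  classical
  obtain ⟨J, hJ⟩ : ∃ J : ℕ, ∀ w ∈ u, ‖w‖ < 2 ^ J * r := by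
    obtain ⟨M, hM⟩ := (u.image norm).exists_le
    obtain ⟨J, hJ⟩ := pow_unbounded_of_one_lt (M / r) (one_lt_two : (1 : ℝ) < 2)
    exact ⟨J, fun w hw => (hM _ (Finset.mem_image_of_mem _ hw)).trans_lt ((div_lt_iff₀ hr).mp hJ)⟩
  -- Dyadic shells: if `j = k + 1` is the first index with `‖w‖ < 2 ^ j * r`, the `j`-th term is
  -- exactly `(2 ^ k * r) ^ (-2)`. The case `j = 0` is excluded by `r ≤ ‖w‖`.
  have hpt : ∀ w ∈ u, (‖w‖ ^ 2)⁻¹ ≤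
      ∑ j ∈ Finset.range (J + 1), if ‖w‖ < 2 ^ j * r then 4 / r ^ 2 * (1 / 4 : ℝ) ^ j else 0 := by
    intro w hw
    have hex : ∃ j : ℕ, ‖w‖ < 2 ^ j * r := ⟨J, hJ w hw⟩
    have hj := Nat.find_spec hex
    have hjJ : Nat.find hex ≤ J := Nat.find_min' hex (hJ w hw)
    have hmin := fun k => Nat.find_min hex (m := k)
    revert hj hjJ hmin
    generalize Nat.find hex = j
    intro hj hjJ hmin
    have hwr := hZr w (hu w hw)
    refine le_trans ?_ (Finset.single_le_sum (f := fun j =>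
      if ‖w‖ < 2 ^ j * r then 4 / r ^ 2 * (1 / 4 : ℝ) ^ j else 0)
      (fun i _ => by split_ifs <;> positivity)
      (Finset.mem_range.mpr (Nat.lt_succ_of_le hjJ)))
    rw [if_pos hj]
    rcases j with _ | k
    · simp at hj; linarith
    · have h1 : 2 ^ k * r ≤ ‖w‖ := not_lt.mp (hmin k k.lt_succ_self)
      have h2 : (4 : ℝ) / r ^ 2 * (1 / 4) ^ (k + 1) = ((2 ^ k * r) ^ 2)⁻¹ := by
        rw [mul_pow, ← pow_mul, mul_comm k 2, pow_mul, one_div_pow]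
        norm_num
        field_simp
        ring
      rw [h2]
      gcongr
  refine (Finset.sum_le_sum hpt).trans ?_
  rw [Finset.sum_comm]
  have hin : ∀ j ∈ Finset.range (J + 1),
      (∑ w ∈ u, if ‖w‖ < 2 ^ j * r then 4 / r ^ 2 * (1 / 4 : ℝ) ^ j else 0) ≤
        4 * C / r * (1 / 2 : ℝ) ^ j := by
    intro j _
    rw [← Finset.sum_filter, Finset.sum_const, nsmul_eq_mul]
    have := hcard (2 ^ j * r) (by positivity) (u.filter fun w => ‖w‖ < 2 ^ j * r) fun w hw =>
      ⟨hu w (Finset.mem_filter.mp hw).1, (Finset.mem_filter.mp hw).2⟩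
    refine (mul_le_mul_of_nonneg_right this (by positivity)).trans_eq ?_
    have h4 : (1 / 4 : ℝ) ^ j = (1 / 2) ^ j * (1 / 2) ^ j := by rw [← mul_pow]; norm_num
    have h5 : (2 : ℝ) ^ j * (1 / 2) ^ j = 1 := by rw [← mul_pow]; norm_num
    have h6 : r * (4 / r ^ 2) = 4 / r := by field_simp
    rw [h4]
    linear_combination C * (4 / r) * (1 / 2) ^ j * h5 +
      C * 2 ^ j * (1 / 2) ^ j * (1 / 2) ^ j * h6
  refine (Finset.sum_le_sum hin).trans ?_
  rw [← Finset.mul_sum]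
  have hgeo : ∑ j ∈ Finset.range (J + 1), (1 / 2 : ℝ) ^ j ≤ 2 := by
    have := summable_geometric_two.sum_le_tsum (Finset.range (J + 1)) (fun i _ => by positivity)
    rwa [tsum_geometric_two] at this
  calc 4 * C / r * ∑ j ∈ Finset.range (J + 1), (1 / 2 : ℝ) ^ j ≤ 4 * C / r * 2 := by gcongr
    _ = 8 * C / r := by ring

/-- **Power sums of reciprocal zeros**: for an entire function of exponential type with simple
zeros, the Taylor coefficients of the logarithmic derivative beyond the constant one are the power
sums of the reciprocals of the zeros. -/
theorem hasSum_inv_pow_zeros {f : ℂ → ℂ} (hf : Differentiable ℂ f) (hf0 : f 0 = 1)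
    {c : ℝ} (hc : 0 < c) (hb : ∀ z, ‖f z‖ ≤ Real.exp (c * ‖z‖))
    (hs : ∀ w, f w = 0 → deriv f w ≠ 0) {m : ℕ} (hm : 1 ≤ m) :
    HasSum (fun w : {w : ℂ | f w = 0} => (w : ℂ)⁻¹ ^ (m + 1))
      (-(iteratedDeriv m (logDeriv f) 0) / m !) := by
  classical
  have hfin : ∀ R : ℝ, {w : ℂ | f w = 0 ∧ ‖w‖ < R}.Finite := fun R =>
    finite_zeros_ball hf (by simp [hf0]) R
  set S : ℝ → Finset ℂ := fun R => (hfin R).toFinset with hSdef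
  have hS : ∀ R w, w ∈ S R ↔ f w = 0 ∧ ‖w‖ < R := fun R w => by simp [S]
  have hsph : ∀ R : ℝ, ∀ z ∈ sphere (0 : ℂ) R, ‖f z‖ ≤ Real.exp (c * R) := fun R z hz => by
    have hzn : ‖z‖ = R := by simpa using hz
    exact hzn ▸ hb z
  have hlog2 : 0 < Real.log 2 := Real.log_pos one_lt_two
  set C : ℝ := 2 * c / Real.log 2 with hCdef
  have hC : 0 ≤ C := by positivity
  have hcardS : ∀ R : ℝ, 0 < R → ((S R).card : ℝ) ≤ C * R := fun R hR => by
    have := card_zeros_le hf hf0 hR (hsph (2 * R)) hs (hS R) (hS (2 * R))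
    rw [hCdef, div_mul_eq_mul_div, le_div_iff₀ hlog2]
    linarith
  obtain ⟨r, hr, hrZ⟩ : ∃ r > 0, ∀ w ∈ {w : ℂ | f w = 0}, r ≤ ‖w‖ := by
    have h := hf.continuous.continuousAt.eventually_ne (x := 0) (y := 0) (by simp [hf0])
    obtain ⟨r, hr, hr'⟩ := Metric.eventually_nhds_iff_ball.mp h
    refine ⟨r, hr, fun w hw => ?_⟩
    by_contra! hlt
    exact hr' w (mem_ball_zero_iff.mpr hlt) hw
  have hsum : Summable (fun w : {w : ℂ | f w = 0} => (w : ℂ)⁻¹ ^ (m + 1)) := by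
    have h2 : Summable (fun w : {w : ℂ | f w = 0} => (‖(w : ℂ)‖ ^ 2)⁻¹) := by
      refine summable_of_sum_le (fun _ => by positivity) (c := 8 * C / r) fun u => ?_
      have := sum_inv_sq_le hr hC hrZ (fun R hR T hT => le_trans
        (Nat.cast_le.mpr (Finset.card_le_card fun w hw => (hS R w).mpr (hT w hw))) (hcardS R hR))
        (u.map (Function.Embedding.subtype _)) (fun w hw => by
          obtain ⟨v, -, rfl⟩ := Finset.mem_map.mp hw
          exact v.2)
      rwa [Finset.sum_map] at this
    refine Summable.of_norm_bounded (h2.mul_left ((1 / r) ^ (m - 1))) fun w => ?_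
    have hw := hrZ w w.2
    obtain ⟨k, rfl⟩ := Nat.exists_eq_add_of_le' hm
    have hw0 : 0 < ‖(w : ℂ)‖ := hr.trans_le hw
    rw [norm_pow, norm_inv, add_assoc, pow_add, add_tsub_cancel_right, inv_pow ‖(w : ℂ)‖ (1 + 1)]
    refine mul_le_mul_of_nonneg_right (pow_le_pow_left₀ (by positivity) ?_ _) (by positivity)
    rw [one_div]
    gcongr
  set T : ℕ → Finset {w : ℂ | f w = 0} := fun N => (S N).subtype _
  have hT : Tendsto T atTop atTop := by
    refine tendsto_atTop_finset_of_monotone (fun M N hMN w hw => ?_) fun w => ?_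
    · rw [Finset.mem_subtype, hS] at hw ⊢
      exact ⟨hw.1, hw.2.trans_le (Nat.cast_le.mpr hMN)⟩
    · obtain ⟨N, hN⟩ := exists_nat_gt ‖(w : ℂ)‖
      exact ⟨N, by rw [Finset.mem_subtype, hS]; exact ⟨w.2, hN⟩⟩
  have hlim1 : Tendsto (fun N : ℕ => ∑ w ∈ S N, w⁻¹ ^ (m + 1)) atTop
      (𝓝 (∑' w : {w : ℂ | f w = 0}, (w : ℂ)⁻¹ ^ (m + 1))) := by
    refine (hsum.hasSum.comp hT).congr fun N => ?_
    refine Finset.sum_subtype_of_mem (fun w : ℂ => w⁻¹ ^ (m + 1)) fun w hw => ((hS N w).mp hw).1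
  have hlim2 : Tendsto (fun N : ℕ => iteratedDeriv m (logDeriv f) 0 +
      m ! * ∑ w ∈ S N, w⁻¹ ^ (m + 1)) atTop (𝓝 0) := by
    set K : ℝ := (m + 1)! * (2 * c) * 2 ^ (m + 1) + m ! * C
    refine squeeze_zero_norm' (a := fun N : ℕ => K / N) ?_ (tendsto_const_div_atTop_nhds_zero_nat K)
    filter_upwards [eventually_ge_atTop 1] with N hN
    have hN1 : (1 : ℝ) ≤ N := by exact_mod_cast hN
    have hN0 : (0 : ℝ) < N := by linarith
    refine (norm_iteratedDeriv_logDeriv_add_sum_le hf hf0 hN0 (by positivity) (hsph N) hs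
      (hS N) m).trans ?_
    obtain ⟨k, rfl⟩ := Nat.exists_eq_add_of_le' hm
    -- Both errors are linear in `N` over `N ^ (m + 1)`; they vanish in the limit because `m ≥ 1`.
    have hpow : (N : ℝ) / N ^ (k + 1 + 1) ≤ 1 / N := by
      rw [div_le_div_iff₀ (by positivity) hN0]
      have : (1 : ℝ) ≤ N ^ k := one_le_pow₀ hN1
      have h2 : (N : ℝ) ^ (k + 1 + 1) = N ^ k * (N * N) := by ring
      rw [h2, one_mul]
      exact le_mul_of_one_le_left (by positivity) this
    have hcd := hcardS N hN0
    calc _ ≤ ((k + 1 + 1)! : ℝ) * (2 * (c * N)) / (N / 2) ^ (k + 1 + 1) +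
          (k + 1)! * (C * N * (1 / N) ^ (k + 1 + 1)) := by gcongr
      _ = K * (N / N ^ (k + 1 + 1)) := by
        simp only [K, div_pow, one_pow]
        field_simp
      _ ≤ K * (1 / N) := by
        refine mul_le_mul_of_nonneg_left hpow ?_
        simp only [K]; positivity
      _ = K / N := by ring
  have hmf : (m ! : ℂ) ≠ 0 := by exact_mod_cast m.factorial_ne_zero
  have huniq := tendsto_nhds_unique hlim2 ((hlim1.const_mul (m ! : ℂ)).const_add _)
  convert hsum.hasSum using 1
  rw [div_eq_iff hmf]
  linear_combination huniq

/-! ### The Kummer function `Φ_{1,b}` -/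

lemma norm_add_natCast_ge {b : ℝ} (hb : 0 < b) (n : ℕ) : (n : ℝ) + 1 ≤ ‖((1 : ℂ) + b) + n‖ := by
  have h : ((1 : ℂ) + b) + n = ((1 + b + n : ℝ) : ℂ) := by push_cast; ring
  rw [h, Complex.norm_real, Real.norm_of_nonneg (by positivity)]
  linarith

/-- Factor by factor, `1 + b + j ≥ 1 + j`. This makes the exponential series a majorant of
`Φ_{1,b}`. -/
lemma ascPochhammer_eval_add_one {b : ℝ} (hb : 0 < b) (k : ℕ) :
    (k ! : ℝ) ≤ ‖(ascPochhammer ℂ k).eval ((1 : ℂ) + b)‖ := by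
  induction k with
  | zero => simp
  | succ k ih =>
    rw [ascPochhammer_succ_eval, norm_mul, Nat.factorial_succ]
    push_cast
    rw [mul_comm]
    exact mul_le_mul ih (norm_add_natCast_ge hb k) (by positivity) (norm_nonneg _)

lemma ascPochhammer_eval_ne_zero {b : ℝ} (hb : 0 < b) (k : ℕ) :
    (ascPochhammer ℂ k).eval ((1 : ℂ) + b) ≠ 0 := by
  rw [← norm_pos_iff]
  exact lt_of_lt_of_le (by exact_mod_cast k.factorial_pos) (ascPochhammer_eval_add_one hb k)

lemma kummerPhi_one_eq (b : ℝ) (z : ℂ) :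
    kummerPhi 1 b z = ∑' k : ℕ, z ^ k / (ascPochhammer ℂ k).eval ((1 : ℂ) + b) := by
  unfold kummerPhi kummerM
  refine tsum_congr fun k => ?_
  have hk : (k ! : ℂ) ≠ 0 := by exact_mod_cast k.factorial_ne_zero
  rw [Complex.ofReal_one, ascPochhammer_eval_one]
  field_simp

lemma norm_kummerPhi_term_le {b : ℝ} (hb : 0 < b) (z : ℂ) (k : ℕ) :
    ‖z ^ k / (ascPochhammer ℂ k).eval ((1 : ℂ) + b)‖ ≤ ‖z‖ ^ k / k ! := by
  rw [norm_div, norm_pow]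
  gcongr
  exact ascPochhammer_eval_add_one hb k

lemma summable_kummerPhi_term {b : ℝ} (hb : 0 < b) (z : ℂ) :
    Summable fun k : ℕ => z ^ k / (ascPochhammer ℂ k).eval ((1 : ℂ) + b) :=
  (Real.summable_pow_div_factorial ‖z‖).of_norm_bounded (norm_kummerPhi_term_le hb z)

lemma norm_kummerPhi_one_le {b : ℝ} (hb : 0 < b) (z : ℂ) :
    ‖kummerPhi 1 b z‖ ≤ Real.exp ‖z‖ := by
  rw [kummerPhi_one_eq, Real.exp_eq_exp_ℝ]
  exact tsum_of_norm_bounded (NormedSpace.expSeries_div_hasSum_exp ‖z‖)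
    (norm_kummerPhi_term_le hb z)

lemma kummerPhi_one_zero (b : ℝ) : kummerPhi 1 b 0 = 1 := by
  rw [kummerPhi_one_eq, tsum_eq_single 0 fun k hk => by simp [hk]]
  simp

lemma norm_kummerPhi_term_le_of_mem_ball {b : ℝ} (hb : 0 < b) (R : ℝ) (k : ℕ) (z : ℂ)
    (hz : z ∈ ball (0 : ℂ) R) :
    ‖z ^ k / (ascPochhammer ℂ k).eval ((1 : ℂ) + b)‖ ≤ R ^ k / k ! := by
  refine (norm_kummerPhi_term_le hb z k).trans ?_
  have := (mem_ball_zero_iff.mp hz).le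
  gcongr

lemma differentiable_kummerPhi_one {b : ℝ} (hb : 0 < b) : Differentiable ℂ (kummerPhi 1 b) := by
  intro z
  have hz : z ∈ ball (0 : ℂ) (‖z‖ + 1) := by simp
  rw [funext (kummerPhi_one_eq b)]
  exact (Complex.differentiableOn_tsum_of_summable_norm
    (Real.summable_pow_div_factorial (‖z‖ + 1)) (fun k => by fun_prop) isOpen_ball
    (norm_kummerPhi_term_le_of_mem_ball hb _)).differentiableAt (isOpen_ball.mem_nhds hz)

/-- Kummer's first-order differential equation for `Φ_{1,b}`. -/
lemma mul_deriv_kummerPhi_one {b : ℝ} (hb : 0 < b) (z : ℂ) :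
    z * deriv (kummerPhi 1 b) z = (z - b) * kummerPhi 1 b z + b := by
  set a : ℕ → ℂ := fun k => (ascPochhammer ℂ k).eval ((1 : ℂ) + b) with ha
  have hz : z ∈ ball (0 : ℂ) (‖z‖ + 1) := by simp
  have hd : HasSum (fun k : ℕ => (k : ℂ) * z ^ (k - 1) / a k) (deriv (kummerPhi 1 b) z) := by
    have h := Complex.hasSum_deriv_of_summable_norm
      (Real.summable_pow_div_factorial (‖z‖ + 1))
      (F := fun (k : ℕ) (z : ℂ) => z ^ k / (ascPochhammer ℂ k).eval ((1 : ℂ) + b))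
      (fun k => by fun_prop) isOpen_ball (norm_kummerPhi_term_le_of_mem_ball hb _) hz
    rw [← funext (kummerPhi_one_eq b)] at h
    simpa using h
  have hs : HasSum (fun k : ℕ => z ^ k / a k) (kummerPhi 1 b z) := by
    rw [kummerPhi_one_eq]
    exact (summable_kummerPhi_term hb z).hasSum
  -- The constant term `b` of `z f' + b f` is split off; the rest, shifted by one, is the series of
  -- `z f` since `(1+b)_{k+1} = (1+b)_k (1+b+k)`.
  have h1 := (hasSum_nat_add_iff' 1).mpr ((hd.mul_left z).add (hs.mul_left (b : ℂ)))
  have h2 := hs.mul_left z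
  have hterm : ∀ k : ℕ, z * (((k + 1 : ℕ) : ℂ) * z ^ (k + 1 - 1) / a (k + 1)) +
      b * (z ^ (k + 1) / a (k + 1)) = z * (z ^ k / a k) := fun k => by
    have hk := ascPochhammer_eval_ne_zero hb k
    have hk1 := ascPochhammer_eval_ne_zero hb (k + 1)
    have hrec : a (k + 1) = a k * (1 + b + k) := ascPochhammer_succ_eval k _
    have hne : (1 + b + k : ℂ) ≠ 0 := fun h0 => hk1 (by
      rw [ascPochhammer_succ_eval, h0, mul_zero])
    change a k ≠ 0 at hk
    rw [hrec, add_tsub_cancel_right]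
    push_cast
    field_simp
    ring
  have h3 := h1.unique (h2.congr_fun hterm)
  simp [a] at h3
  linear_combination h3

lemma deriv_kummerPhi_one_ne_zero {b : ℝ} (hb : 0 < b) {w : ℂ} (hw : kummerPhi 1 b w = 0) :
    deriv (kummerPhi 1 b) w ≠ 0 := by
  intro h0
  have := mul_deriv_kummerPhi_one hb w
  rw [h0, hw] at this
  simp only [mul_zero, zero_add] at this
  exact hb.ne (by exact_mod_cast this)

lemma analyticOrderNatAt_kummerPhi_one {b : ℝ} (hb : 0 < b) {w : ℂ} (hw : kummerPhi 1 b w = 0) :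
    analyticOrderNatAt (kummerPhi 1 b) w = 1 := by
  have ha := (differentiable_kummerPhi_one hb).analyticAt w
  have := ha.analyticOrderAt_eq_one_of_zero_deriv_ne_zero hw (deriv_kummerPhi_one_ne_zero hb hw)
  simp [analyticOrderNatAt, this]

lemma deriv_kummerPhi_one_zero {b : ℝ} (hb : 0 < b) :
    deriv (kummerPhi 1 b) 0 = 1 / (1 + b) := by
  have hd := differentiable_kummerPhi_one hb
  have hd2 : DifferentiableAt ℂ (deriv (kummerPhi 1 b)) 0 :=
    ((hd.analyticAt 0).deriv).differentiableAt
  have h := congrArg (fun F => deriv F 0) (funext (mul_deriv_kummerPhi_one hb))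
  rw [deriv_fun_mul differentiableAt_fun_id hd2, deriv_add_const,
    deriv_fun_mul (by fun_prop) (hd 0)] at h
  simp [kummerPhi_one_zero] at h
  have hne : (1 + b : ℂ) ≠ 0 := by
    have : ((1 + b : ℝ) : ℂ) ≠ 0 := by exact_mod_cast (by positivity : (1 + b : ℝ) ≠ 0)
    simpa using this
  rw [eq_div_iff hne]
  linear_combination h

/-! ### Bernoulli numbers and the logarithmic derivative -/

lemma one_div_kummerPhi_one_eventuallyEq {b : ℝ} (hb : 0 < b) :
    (fun z => 1 / kummerPhi 1 b z) =ᶠ[𝓝 0]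
      fun z => (1 - z * (b : ℂ)⁻¹) + z * logDeriv (kummerPhi 1 b) z * (b : ℂ)⁻¹ := by
  have hne := (differentiable_kummerPhi_one hb).continuous.continuousAt.eventually_ne
    (x := 0) (y := 0) (by simp [kummerPhi_one_zero])
  filter_upwards [hne] with z hz
  have hb' : (b : ℂ) ≠ 0 := by exact_mod_cast hb.ne'
  have := mul_deriv_kummerPhi_one hb z
  rw [logDeriv_apply]
  field_simp
  linear_combination -this

lemma hypergeometricBernoulli_succ {b : ℝ} (hb : 0 < b) (m : ℕ) :
    hypergeometricBernoulli b (m + 1) =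
      (if m = 0 then -(b : ℂ)⁻¹ else 0) +
        (m + 1) * iteratedDeriv m (logDeriv (kummerPhi 1 b)) 0 * (b : ℂ)⁻¹ := by
  have ha := (differentiable_kummerPhi_one hb).analyticAt 0
  have hL : ∀ n : ℕ, ContDiffAt ℂ n (logDeriv (kummerPhi 1 b)) 0 := fun n =>
    (ha.deriv.div ha (by simp [kummerPhi_one_zero])).contDiffAt
  unfold hypergeometricBernoulli
  rw [(one_div_kummerPhi_one_eventuallyEq hb).iteratedDeriv_eq, iteratedDeriv_fun_add
    (by fun_prop) ((contDiffAt_fun_id.mul (hL _)).mul contDiffAt_const)]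
  congr 1
  · rw [iteratedDeriv_const_sub m.succ_pos]
    change iteratedDeriv (m + 1) (-fun z : ℂ => z * (b : ℂ)⁻¹) 0 = _
    rw [iteratedDeriv_neg, iteratedDeriv_mul_const_field, iteratedDeriv_fun_id_zero]
    split_ifs <;> simp_all
  · rw [iteratedDeriv_mul_const_field, iteratedDeriv_fun_mul contDiffAt_fun_id (hL _)]
    congr 1
    -- In Leibniz's formula only the first derivative of `z` survives at 0, with binomial
    -- coefficient `m + 1`.
    rw [Finset.sum_eq_single 1]
    · simp [iteratedDeriv_fun_id_zero]
    · intro i _ hi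
      simp [iteratedDeriv_fun_id_zero, hi]
    · simp

theorem mainTheorem7 (b : ℕ) (hb : 1 ≤ b) :
    hypergeometricBernoulli (b : ℝ) 0 = 1 ∧
    hypergeometricBernoulli (b : ℝ) 1 = -1 / (1 + (b : ℂ)) ∧
    ∀ n : ℕ, 2 ≤ n →
      Summable (hypergeometricZetaTerm 1 (b : ℝ) (n : ℂ)) ∧
      hypergeometricBernoulli (b : ℝ) n =
        -((n ! : ℂ) * hypergeometricZeta 1 (b : ℝ) (n : ℂ)) / (b : ℂ) := by
  have hb0 : (0 : ℝ) < b := by exact_mod_cast hb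
  have hbC : (b : ℂ) ≠ 0 := by exact_mod_cast hb0.ne'
  refine ⟨by simp [hypergeometricBernoulli, kummerPhi_one_zero], ?_, fun n hn => ?_⟩
  -- Index 1 involves the value of `f'/f` at 0, which the power-sum theorem does not cover; it is
  -- `f'(0) = 1/(1+b)`.
  · have hne : (1 + b : ℂ) ≠ 0 := by exact_mod_cast (by omega : 1 + b ≠ 0)
    rw [hypergeometricBernoulli_succ hb0 0, iteratedDeriv_zero, logDeriv_apply,
      deriv_kummerPhi_one_zero hb0, kummerPhi_one_zero]
    push_cast
    field_simp
    simp
  · obtain ⟨m, rfl⟩ := Nat.exists_eq_add_of_le' (show 1 ≤ n by omega)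
    have hm : 1 ≤ m := by omega
    have hsum := hasSum_inv_pow_zeros (differentiable_kummerPhi_one hb0) (kummerPhi_one_zero _)
      one_pos (fun z => by simpa using norm_kummerPhi_one_le hb0 z)
      (fun w => deriv_kummerPhi_one_ne_zero hb0) hm
    have hterm : hypergeometricZetaTerm 1 (b : ℝ) ((m + 1 : ℕ) : ℂ) =
        fun w : kummerZeros 1 (b : ℝ) => (w : ℂ)⁻¹ ^ (m + 1) := by
      funext w
      rw [hypergeometricZetaTerm, analyticOrderNatAt_kummerPhi_one hb0 w.2, Complex.cpow_natCast]
      simp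
    refine ⟨hterm ▸ hsum.summable, ?_⟩
    have hz : hypergeometricZeta 1 (b : ℝ) ((m + 1 : ℕ) : ℂ) =
        -(iteratedDeriv m (logDeriv (kummerPhi 1 b)) 0) / m ! := by
      rw [hypergeometricZeta, hterm]
      exact hsum.tsum_eq
    have hmf : (m ! : ℂ) ≠ 0 := by exact_mod_cast m.factorial_ne_zero
    rw [hz, hypergeometricBernoulli_succ hb0, if_neg (by omega), Nat.factorial_succ]
    push_cast
    field_simp
    ring
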